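/- A Motzkin permutation of length $n\ge 0$ is a permutation $\pi$ of $\{1,\dots,n\}$ that avoids the classical pattern $132$ and for which there are no indices $a<b$ with $\pi_a<\pi_b<\pi_{b+1}$. For $k\ge 2$, an occurrence of the generalized pattern $12\text{-}3\text{-}\cdots\text{-}k$ in $\pi$ is a sequence of positions $i_1<i_2<\dots<i_k$ with $i_2=i_1+1$ and $\pi_{i_1}<\pi_{i_2}<\dots<\pi_{i_k}$. Let $$N_k(x;r)=\sum_{n\ge 0}\#\{\pi\text{ a Motzkin permutation of length }n\text{ with exactly }r\text{ occurrences of }12\text{-}3\text{-}\cdots\text{-}k\}\,x^n ,$$ let $U_m$ be the Chebyshev polynomials of the second kind ($U_0(t)=1$, $U_1(t)=2t$, $U_m(t)=2tU_{m-1}(t)-U_{m-2}(t)$), and put $z=\frac{1-x}{2x}$. Then for every $k\ge 2$, as formal Laurent series in $x$ over $\mathbb{Q}$, $$N_k(x;0)=\frac{U_{k-2}(z)}{x\,U_{k-1}(z)},$$ and for all $r=1,2,\dots,k-1$, $$N_k(x;r)=\frac{x^{r-1}\,U_{k-2}(z)^{r-1}}{(1-x)^r\,U_{k-1}(z)^{r+1}}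 .$$ -/

import Mathlib

/-- `f` is (the list of positions of) an occurrence in `π` of the generalized pattern with
underlying permutation `τ`, where the letters `i` and `i + 1` (counted from `0`) of the pattern
are required to be adjacent in `π` exactly when `i ∈ adj`, that is, when there is no dash
between them. The case `adj = ∅` is that of classical patterns. -/
def IsOccurrence {k n : ℕ} (τ : Equiv.Perm (Fin k)) (adj : Set ℕ) (π : Equiv.Perm (Fin n))
    (f : Fin k ↪o Fin n) : Prop :=
  (∀ i j : Fin k, π (f i) < π (f j) ↔ τ i < τ j) ∧
    ∀ i j : Fin k, (j : ℕ) = i + 1 → (i : ℕ) ∈ adj → (f j : ℕ) = f i + 1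

/-- The number of occurrences of a generalized pattern in `π`. -/
noncomputable def occurrences {k n : ℕ} (τ : Equiv.Perm (Fin k)) (adj : Set ℕ)
    (π : Equiv.Perm (Fin n)) : ℕ :=
  Nat.card {f : Fin k ↪o Fin n // IsOccurrence τ adj π f}

/-- `π` has no occurrence of a generalized pattern. -/
def Avoids {k n : ℕ} (τ : Equiv.Perm (Fin k)) (adj : Set ℕ) (π : Equiv.Perm (Fin n)) : Prop :=
  ∀ f : Fin k ↪o Fin n, ¬ IsOccurrence τ adj π f

/-- Motzkin permutations: those avoiding the classical pattern `132` and the generalized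
pattern `1-23`. -/
def IsMotzkinPerm {n : ℕ} (π : Equiv.Perm (Fin n)) : Prop :=
  Avoids (Equiv.swap (1 : Fin 3) 2) ∅ π ∧ Avoids (Equiv.refl (Fin 3)) {1} π

/-- The number of Motzkin permutations of length `n` that contain the generalized pattern
`12-3-…-k` exactly `r` times. -/
noncomputable def motzkinCount (k r n : ℕ) : ℕ :=
  Nat.card {π : Equiv.Perm (Fin n) //
    IsMotzkinPerm π ∧ occurrences (Equiv.refl (Fin k)) {0} π = r}

/-- The generating function of the numbers `motzkinCount k r n`. -/
noncomputable def motzkinGF (k r : ℕ) : PowerSeries ℚ :=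
  PowerSeries.mk fun n => (motzkinCount k r n : ℚ)

/-- The variable `x` in the field of formal Laurent series. -/
noncomputable def xL : LaurentSeries ℚ := ((PowerSeries.X : PowerSeries ℚ) : LaurentSeries ℚ)

/-- `U_m((1 - x) / (2 x))`, with `U_m` the Chebyshev polynomial of the second kind, as a formal
Laurent series in `x`. -/
noncomputable def chebU (m : ℤ) : LaurentSeries ℚ :=
  Polynomial.aeval ((1 - xL) / (2 * xL)) (Polynomial.Chebyshev.U ℚ m)

/-! Cut a nonempty Motzkin permutation at its largest letter `M`. Avoiding 132 puts every letter
before `M` above every letter after it. If some letter precedes `M`, avoiding 1-23 makes its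
immediate predecessor `m` the smallest of those before `M`. So the word is `M t` or `l m M t` with
`t < m < l < M`, and `l`, `t` are again Motzkin words. This is the first-return decomposition of
Motzkin paths (`exists_toList_eq`, `toList_injective`).

In `l m M t` the letter `m` neither ends a rise begun in `l` nor extends an increasing sequence from
`l`, whereas `M` extends every such sequence. An occurrence of 12-3-…-(j+2) thus lies in `t`, or in
`l`, or is a shorter one in `l` followed by `M`; for j = 0 the rise `m M` is one more. By Pascal's
rule an up step starting at height i contributes `i.choose j` (`riseCount_toList`).

Let q mark occurrences and F_d enumerate paths started at height d. Then F_d = 1 + x F_d + x² q^(d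
choose j) F_(d+1) F_d, a continued fraction. The exponents are 0 below height j, 1 at j, and j+1 at
j+1, so modulo q^(j+2) it stops after height j+1, with value D_j / D_(j+1), where D_e is
`convergentDen e` (`X_pow_dvd_convergentDen_mul_sub`). Each D_e is linear in q with Chebyshev
coefficients, so from q² on the coefficients of F_0 are geometric. The Cassini identity
`chebU_sq_sub` evaluates the coefficient of q. The truncation order gives the range r ≤ j+1 = k-1.
-/

/-! ### Motzkin paths as trees, their weights and words. -/

/-- Unary-binary trees with internal nodes of size one (`flat`) and two (`arch`); they encode
Motzkin paths, an arch `U s D t` being `arch s t`. -/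
inductive MotzkinTree : Type
  | leaf : MotzkinTree
  | flat : MotzkinTree → MotzkinTree
  | arch : MotzkinTree → MotzkinTree → MotzkinTree
  deriving DecidableEq

namespace MotzkinTree

/-- The number of steps of the Motzkin path. -/
def size : MotzkinTree → ℕ
  | leaf => 0
  | flat t => t.size + 1
  | arch s t => s.size + t.size + 2

/-- The sum over all up steps of the weight `w i` of their starting height `i`. -/
def weight : (ℕ → ℕ) → MotzkinTree → ℕ
  | _, leaf => 0
  | w, flat t => weight w t
  | w, arch s t => w 0 + weight (fun i => w (i + 1)) s + weight w t

/-- The word of the Motzkin permutation of `{c, c + 1, …}` encoded by a tree. -/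
def toList : ℕ → MotzkinTree → List ℕ
  | _, leaf => []
  | c, flat t => (c + t.size) :: toList c t
  | c, arch s t =>
    toList (c + t.size + 1) s ++ (c + t.size) :: (c + s.size + t.size + 1) :: toList c t

theorem weight_add (w w' : ℕ → ℕ) (t : MotzkinTree) :
    weight (fun i => w i + w' i) t = weight w t + weight w' t := by
  induction t generalizing w w' with
  | leaf => rfl
  | flat t ih => exact ih w w'
  | arch s t ihs iht => simp only [weight, ihs, iht]; ring

end MotzkinTree

/-! ### Counting pattern occurrences in words. -/

/-- The number of increasing subsequences of length `j` with all letters larger than `v`. -/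
def incCount : ℕ → ℕ → List ℕ → ℕ
  | 0, _, _ => 1
  | _ + 1, _, [] => 0
  | j + 1, v, a :: l => incCount (j + 1) v l + if v < a then incCount j a l else 0

/-- The number of occurrences of `12-3-…-(j+2)` in a word. -/
def riseCount (j : ℕ) : List ℕ → ℕ
  | [] => 0
  | [_] => 0
  | a :: b :: l => riseCount j (b :: l) + if a < b then incCount j b l else 0

/-- The word avoids `132` and `1-23`. -/
def IsMotzkinWord : List ℕ → Prop
  | [] => True
  | a :: l => l.Pairwise (fun b c => ¬(a < c ∧ c < b)) ∧ l.IsChain (fun b c => ¬(a < b ∧ b < c)) ∧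
      IsMotzkinWord l

@[simp] theorem incCount_zero (v : ℕ) (l : List ℕ) : incCount 0 v l = 1 := by
  cases l <;> rfl

theorem incCount_succ_cons (j v a : ℕ) (l : List ℕ) : incCount (j + 1) v (a :: l) =
    incCount (j + 1) v l + if v < a then incCount j a l else 0 := rfl

theorem riseCount_cons_cons (j a b : ℕ) (l : List ℕ) : riseCount j (a :: b :: l) =
    riseCount j (b :: l) + if a < b then incCount j b l else 0 := rfl

theorem incCount_succ_eq_zero {j v : ℕ} {l : List ℕ} (h : ∀ a ∈ l, a ≤ v) :
    incCount (j + 1) v l = 0 := by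
  induction l with
  | nil => rfl
  | cons a l ih =>
    have h1 := h a (by simp)
    rw [incCount, ih fun b hb => h b (by simp [hb]), if_neg (by omega)]

theorem incCount_of_forall_le {j u v : ℕ} {l : List ℕ} (h : ∀ a ∈ l, a ≤ v) :
    incCount j v l = incCount j u [] := by
  cases j with
  | zero => simp
  | succ j => rw [incCount_succ_eq_zero h, incCount]

/-- Above the threshold only letters of `l` and `M` are usable, and `M`, larger than all of `l`, can
only come last. The bound on `v` is weak at `m` and strict at `M`, and it persists when a letter of
`l` becomes the new threshold. -/
theorem incCount_append {j v m M : ℕ} {l t : List ℕ} (hv : m ≤ v) (hM : v < M)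
    (hl : ∀ a ∈ l, m < a ∧ a < M) (ht : ∀ b ∈ t, b < m) :
    incCount (j + 1) v (l ++ m :: M :: t) = incCount (j + 1) v l + incCount j v l := by
  induction l generalizing j v with
  | nil =>
    rw [List.nil_append, incCount_succ_cons, incCount_succ_cons,
      if_neg (show ¬ v < m by omega), if_pos hM,
      incCount_succ_eq_zero fun b hb => by have := ht b hb; omega,
      incCount_of_forall_le (u := v) fun b hb => by have := ht b hb; omega]
    simp [incCount]
  | cons a l ih =>
    have ha := hl a (by simp)
    have hl' : ∀ a ∈ l, m < a ∧ a < M := fun b hb => hl b (by simp [hb])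
    rw [List.cons_append, incCount_succ_cons, ih hv hM hl']
    cases j with
    | zero => simp [incCount]; ring
    | succ j =>
      rw [ih ha.1.le ha.2 hl', incCount_succ_cons, incCount_succ_cons]
      split_ifs <;> ring

theorem riseCount_cons {j M : ℕ} {t : List ℕ} (ht : ∀ b ∈ t, b < M) :
    riseCount j (M :: t) = riseCount j t := by
  cases t with
  | nil => rfl
  | cons b t => rw [riseCount, if_neg (by have := ht b (by simp); omega), add_zero]

theorem riseCount_zero_append {m M : ℕ} {l t : List ℕ} (hmM : m < M)
    (hl : ∀ a ∈ l, m < a ∧ a < M) (ht : ∀ b ∈ t, b < m) :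
    riseCount 0 (l ++ m :: M :: t) = 1 + riseCount 0 l + riseCount 0 t := by
  induction l with
  | nil =>
    rw [List.nil_append, riseCount_cons_cons, if_pos hmM,
      riseCount_cons fun b hb => by have := ht b hb; omega]
    simp [riseCount]; ring
  | cons a l ih =>
    have ha := hl a (by simp)
    have ih := ih fun b hb => hl b (by simp [hb])
    cases l with
    | nil => rw [List.cons_append, List.nil_append, riseCount_cons_cons, if_neg (by omega)]; exact ih
    | cons b l =>
      rw [List.cons_append, List.cons_append, riseCount_cons_cons, ← List.cons_append, ih,
        riseCount_cons_cons]
      simp; ring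

/-- The step from `l` down to `m` is no rise, and the rise `m M` has nothing larger after it. The
term `riseCount j l` counts the occurrences that end in `M`. -/
theorem riseCount_succ_append {j m M : ℕ} {l t : List ℕ} (hmM : m < M)
    (hl : ∀ a ∈ l, m < a ∧ a < M) (ht : ∀ b ∈ t, b < m) :
    riseCount (j + 1) (l ++ m :: M :: t) =
      riseCount j l + riseCount (j + 1) l + riseCount (j + 1) t := by
  induction l with
  | nil =>
    rw [List.nil_append, riseCount_cons_cons, if_pos hmM,
      riseCount_cons fun b hb => by have := ht b hb; omega,
      incCount_succ_eq_zero fun b hb => by have := ht b hb; omega]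
    simp [riseCount]
  | cons a l ih =>
    have ha := hl a (by simp)
    have ih := ih fun b hb => hl b (by simp [hb])
    cases l with
    | nil => rw [List.cons_append, List.nil_append, riseCount_cons_cons, if_neg (by omega)]; exact ih
    | cons b l =>
      have hb := hl b (by simp)
      rw [List.cons_append, List.cons_append, riseCount_cons_cons, ← List.cons_append, ih,
        riseCount_cons_cons, riseCount_cons_cons, incCount_append hb.1.le hb.2 (fun c hc => hl c (by simp [hc])) ht]
      split_ifs <;> ring

/-! ### Decomposition and assembly of Motzkin words. -/

theorem IsMotzkinWord.of_append {l₁ l₂ : List ℕ} (h : IsMotzkinWord (l₁ ++ l₂)) :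
    IsMotzkinWord l₁ ∧ IsMotzkinWord l₂ ∧ ∀ a ∈ l₁,
      l₂.Pairwise (fun b c => ¬(a < c ∧ c < b)) ∧ l₂.IsChain (fun b c => ¬(a < b ∧ b < c)) := by
  induction l₁ with
  | nil => exact ⟨trivial, h, by simp⟩
  | cons a l ih =>
    obtain ⟨h1, h2, h3⟩ : IsMotzkinWord (a :: (l ++ l₂)) := h
    obtain ⟨i1, i2, i3⟩ := ih h3
    rw [List.pairwise_append] at h1
    rw [List.isChain_append] at h2
    refine ⟨⟨h1.1, h2.1, i1⟩, i2, fun b hb => ?_⟩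
    rcases List.mem_cons.1 hb with rfl | hb
    · exact ⟨h1.2.1, h2.2.1⟩
    · exact i3 b hb

theorem IsMotzkinWord.cons {M : ℕ} {t : List ℕ} (h : IsMotzkinWord t) (ht : ∀ b ∈ t, b < M) :
    IsMotzkinWord (M :: t) := by
  refine ⟨List.pairwise_of_forall_mem_list ?_, List.Pairwise.isChain
    (List.pairwise_of_forall_mem_list ?_), h⟩
  · intro b _ c hc
    have := ht c hc
    omega
  · intro b hb c _
    have := ht b hb
    omega

theorem IsMotzkinWord.append {m M : ℕ} {l t : List ℕ} (hmM : m < M) (h₁ : IsMotzkinWord l)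
    (h₂ : IsMotzkinWord t) (hl : ∀ a ∈ l, m < a ∧ a < M) (ht : ∀ b ∈ t, b < m) :
    IsMotzkinWord (l ++ m :: M :: t) := by
  -- Only `M` exceeds `a` in `m :: M :: t`, while either forbidden pattern needs two letters above
  -- `a`. The weak bound lets `a` be `m` itself as well as a letter of `l`.
  have hr : ∀ a, m ≤ a → a < M → (m :: M :: t).Pairwise (fun b c => ¬(a < c ∧ c < b)) := by
    intro a ha haM
    refine List.pairwise_cons.2 ⟨?_, List.pairwise_cons.2
      ⟨fun b hb => ?_, List.pairwise_of_forall_mem_list fun b _ c hc => ?_⟩⟩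
    · intro b hb
      rcases List.mem_cons.1 hb with rfl | hb
      · omega
      · have := ht b hb
        omega
    · have := ht b hb
      omega
    · have := ht c hc
      omega
  have hc : ∀ a, m ≤ a → a < M → (m :: M :: t).IsChain (fun b c => ¬(a < b ∧ b < c)) := by
    intro a ha haM
    refine List.IsChain.cons_cons (by omega) (List.Pairwise.isChain (List.pairwise_cons.2
      ⟨fun b hb => ?_, List.pairwise_of_forall_mem_list fun b hb c _ => ?_⟩))
    · have := ht b hb
      omega
    · have := ht b hb
      omega
  induction l with
  | nil =>
    have hM : IsMotzkinWord (M :: t) := h₂.cons fun b hb => (ht b hb).trans hmM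
    exact ⟨(hr m le_rfl hmM).tail, (hc m le_rfl hmM).tail, hM⟩
  | cons a l ih =>
    have ha := hl a (by simp)
    refine ⟨List.pairwise_append.2 ⟨h₁.1, hr a ha.1.le ha.2, fun b hb c hcm => ?_⟩,
      List.isChain_append.2 ⟨h₁.2.1, hc a ha.1.le ha.2, fun b hb c hcm => ?_⟩,
      ih h₁.2.2 fun b hb => hl b (by simp [hb])⟩
    · have := hl b (by simp [hb])
      rcases List.mem_cons.1 hcm with rfl | hcm
      · omega
      rcases List.mem_cons.1 hcm with rfl | hcm
      · omega
      · have := ht c hcm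
        omega
    · have := hl b (by simp [List.mem_of_mem_getLast? hb])
      simp only [List.head?_cons, Option.mem_def, Option.some.injEq] at hcm
      omega

/-- If all letters of `t` are smaller than those of `l`, and the letters of both form an interval,
then so do those of `t` and those of `l`. -/
theorem List.Perm.range'_of_append {c n : ℕ} {l t : List ℕ} (h : (l ++ t).Perm (List.range' c n))
    (hlt : ∀ a ∈ l, ∀ b ∈ t, b < a) :
    t.Perm (List.range' c t.length) ∧ l.Perm (List.range' (c + t.length) l.length) := by
  have hn : l.length + t.length = n := by simpa using h.length_eq
  -- Sorting each block gives a globally sorted arrangement of the interval, hence the interval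
  -- itself; cutting it at `t.length` separates the blocks.
  have key : t.mergeSort ++ l.mergeSort = List.range' c n := by
    refine List.Perm.eq_of_pairwise (le := (· ≤ ·)) (fun a b _ _ => Nat.le_antisymm) ?_ ?_ ?_
    · refine List.pairwise_append.2 ⟨?_, ?_, ?_⟩
      · exact List.pairwise_mergeSort' _ _
      · exact List.pairwise_mergeSort' _ _
      · intro a ha b hb
        exact (hlt b (List.mem_mergeSort.1 hb) a (List.mem_mergeSort.1 ha)).le
    · exact (List.pairwise_lt_range' ).imp le_of_lt
    · exact (((List.mergeSort_perm t _).append (List.mergeSort_perm l _)).trans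
        List.perm_append_comm).trans h
  have h2 : List.range' c n = List.range' c t.length ++ List.range' (c + t.length) l.length := by
    rw [← hn, Nat.add_comm l.length, List.range'_append_1]
  rw [h2] at key
  obtain ⟨h3, h4⟩ := List.append_inj key (by simp)
  exact ⟨h3 ▸ (List.mergeSort_perm t _).symm, h4 ▸ (List.mergeSort_perm l _).symm⟩

/-! ### Trees encode exactly the Motzkin words. -/

namespace MotzkinTree

theorem toList_perm (c : ℕ) (t : MotzkinTree) : (t.toList c).Perm (List.range' c t.size) := by
  induction t generalizing c with
  | leaf => rfl
  | flat t ih =>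
    rw [toList, size, List.range'_concat, Nat.one_mul]
    exact ((ih c).cons _).trans (List.perm_append_singleton _ _).symm
  | arch s t ihs iht =>
    have h1 : List.range' c (arch s t).size = List.range' c t.size ++ [c + t.size] ++
        List.range' (c + t.size + 1) s.size ++ [c + s.size + t.size + 1] := by
      have h := List.range'_concat (step := 1) (s := c) (n := s.size + t.size + 1)
      rw [size, h, Nat.one_mul, show s.size + t.size + 1 = (t.size + 1) + s.size by ring,
        ← List.range'_append_1, List.range'_concat, Nat.one_mul]
      simp [add_comm, add_assoc]
    rw [toList, h1]
    have h2 := (ihs (c + t.size + 1)).append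
      (((iht c).cons (c + s.size + t.size + 1)).cons (c + t.size))
    refine h2.trans ?_
    rw [List.perm_iff_count]
    intro a
    simp only [List.count_append, List.count_cons, List.count_nil]
    ring

theorem mem_toList {c a : ℕ} {t : MotzkinTree} : a ∈ t.toList c ↔ c ≤ a ∧ a < c + t.size := by
  rw [(toList_perm c t).mem_iff, List.mem_range'_1]

@[simp] theorem length_toList (c : ℕ) (t : MotzkinTree) : (t.toList c).length = t.size := by
  simpa using (toList_perm c t).length_eq

theorem isMotzkinWord_toList (c : ℕ) (t : MotzkinTree) : IsMotzkinWord (t.toList c) := by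
  induction t generalizing c with
  | leaf => trivial
  | flat t ih => exact (ih c).cons fun b hb => (mem_toList.1 hb).2
  | arch s t ihs iht =>
    refine IsMotzkinWord.append (by omega) (ihs _) (iht c) (fun a ha => ?_)
      fun b hb => (mem_toList.1 hb).2
    have := mem_toList.1 ha
    omega

/-- Inside an arch heights grow by one, and Pascal's rule for `(i + 1).choose (j + 1)` matches the
two terms that `riseCount_succ_append` contributes for `l`. -/
theorem riseCount_toList (j c : ℕ) (t : MotzkinTree) :
    riseCount j (t.toList c) = weight (fun i => i.choose j) t := by
  induction t generalizing j c with
  | leaf => rfl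
  | flat t ih =>
    rw [toList, riseCount_cons fun b hb => (mem_toList.1 hb).2]
    exact ih j c
  | arch s t ihs iht =>
    have hs : ∀ a ∈ toList (c + t.size + 1) s, c + t.size < a ∧ a < c + s.size + t.size + 1 := by
      intro a ha
      have := mem_toList.1 ha
      omega
    have ht : ∀ b ∈ toList c t, b < c + t.size := fun b hb => (mem_toList.1 hb).2
    cases j with
    | zero =>
      rw [toList, riseCount_zero_append (by omega) hs ht, ihs, iht, weight]
      simp
    | succ j =>
      rw [toList, riseCount_succ_append (by omega) hs ht, ihs, ihs, iht, weight]
      simp only [Nat.choose_succ_succ, weight_add, Nat.choose_zero_succ, Nat.zero_add]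

/-- The length gives the size, hence the largest letter, which occurs once. It comes first exactly
for `flat`; in every case cutting there recovers the subtrees' words. -/
theorem toList_injective (c : ℕ) : Function.Injective (toList c) := by
  have key : ∀ (n : ℕ) (c : ℕ) (t t' : MotzkinTree), t.size = n → t.toList c = t'.toList c →
      t = t' := by
    intro n
    induction n using Nat.strong_induction_on with
    | _ n ih =>
    intro c t t' hn h
    have hsz : t.size = t'.size := by rw [← length_toList c, h, length_toList]
    have aux : ∀ (s t : MotzkinTree), ∀ a ∈ toList (c + t.size + 1) s ++ [c + t.size],
        a ≠ c + s.size + t.size + 1 := by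
      intro s t a ha
      simp only [List.mem_append, mem_toList, List.mem_singleton] at ha
      omega
    have split : ∀ {M : ℕ} {l₁ l₂ t₁ t₂ : List ℕ}, (∀ a ∈ l₁, a ≠ M) → (∀ a ∈ l₂, a ≠ M) →
        l₁ ++ M :: t₁ = l₂ ++ M :: t₂ → l₁ = l₂ ∧ t₁ = t₂ := by
      intro M l₁ l₂ t₁ t₂ h₁ h₂ h
      induction l₁ generalizing l₂ with
      | nil => cases l₂ <;> simp_all
      | cons a l ih =>
        cases l₂ with
        | nil => simp_all
        | cons b l₂ =>
          simp only [List.cons_append, List.cons.injEq] at h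
          obtain ⟨h3, h4⟩ := ih (fun a ha => h₁ a (by simp [ha])) (fun a ha => h₂ a (by simp [ha]))
            h.2
          exact ⟨by rw [h.1, h3], h4⟩
    cases t with
    | leaf => cases t' <;> simp_all [size]
    | flat t =>
      cases t' with
      | leaf => simp [size] at hsz
      | flat t' =>
        simp only [toList, List.cons.injEq] at h
        simp only [size] at hn
        rw [ih t.size (by omega) c t t' rfl h.2]
      | arch s' t' =>
        simp only [size] at hsz
        have h' : [] ++ (c + s'.size + t'.size + 1) :: toList c t =
            (toList (c + t'.size + 1) s' ++ [c + t'.size]) ++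
              (c + s'.size + t'.size + 1) :: toList c t' := by
          rw [toList, toList, show c + t.size = c + s'.size + t'.size + 1 by omega] at h
          simpa using h
        have := (split (by simp) (aux s' t') h').1
        simp at this
    | arch s t =>
      cases t' with
      | leaf => simp [size] at hsz
      | flat t' =>
        simp only [size] at hsz
        have h' : (toList (c + t.size + 1) s ++ [c + t.size]) ++
              (c + s.size + t.size + 1) :: toList c t =
            [] ++ (c + s.size + t.size + 1) :: toList c t' := by
          rw [toList, toList, show c + t'.size = c + s.size + t.size + 1 by omega] at h
          simpa using h
        have := (split (aux s t) (by simp) h').1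
        simp at this
      | arch s' t' =>
        simp only [size] at hsz hn
        have e : c + s'.size + t'.size + 1 = c + s.size + t.size + 1 := by omega
        have h' : (toList (c + t.size + 1) s ++ [c + t.size]) ++
              (c + s.size + t.size + 1) :: toList c t =
            (toList (c + t'.size + 1) s' ++ [c + t'.size]) ++
              (c + s.size + t.size + 1) :: toList c t' := by
          rw [toList, toList, e] at h
          simpa using h
        obtain ⟨h1, h2⟩ := split (aux s t) (fun a ha => e ▸ aux s' t' a ha) h'
        have ht := ih t.size (by omega) c t t' rfl h2
        subst ht
        rw [ih s.size (by omega) _ s s' rfl (List.append_inj_left' h1 rfl)]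
  exact fun t t' h => key t.size c t t' rfl h

theorem exists_toList_eq {c n : ℕ} {l : List ℕ} (hp : l.Perm (List.range' c n))
    (hl : IsMotzkinWord l) : ∃ t : MotzkinTree, t.size = n ∧ t.toList c = l := by
  induction n using Nat.strong_induction_on generalizing c l with
  | _ n ih =>
  cases n with
  | zero => exact ⟨leaf, rfl, by simpa [toList, eq_comm] using hp⟩
  | succ n =>
    have hmem : c + n ∈ l := by rw [hp.mem_iff, List.mem_range'_1]; omega
    obtain ⟨l₁, t, rfl⟩ := List.append_of_mem hmem
    have hlen : l₁.length + t.length = n := by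
      have := hp.length_eq
      simp at this
      omega
    have hp' : (l₁ ++ t).Perm (List.range' c n) := by
      have h1 := (List.perm_middle (l₁ := l₁) (l₂ := t) (a := c + n)).symm.trans hp
      rw [List.range'_concat, Nat.one_mul] at h1
      exact (List.perm_cons _).1 (h1.trans (List.perm_append_singleton _ _))
    have hnd : (l₁ ++ t).Nodup := hp'.nodup_iff.2 List.nodup_range'
    obtain ⟨m1, m2, m3⟩ := hl.of_append
    -- Otherwise `a`, the maximum `c + n` and `b` would form a 132.
    have hlt : ∀ a ∈ l₁, ∀ b ∈ t, b < a := by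
      intro a ha b hb
      have h1 := (List.pairwise_cons.1 (m3 a ha).1).1 b hb
      have h2 : b ∈ List.range' c n := hp'.mem_iff.1 (by simp [hb])
      have h3 : a ≠ b := (List.nodup_append.1 hnd).2.2 a ha b hb
      rw [List.mem_range'_1] at h2
      omega
    obtain ⟨ht, hl₁⟩ := hp'.range'_of_append hlt
    obtain ⟨T, hT, hT'⟩ := ih t.length (by omega) ht m2.2.2
    rcases List.eq_nil_or_concat l₁ with rfl | ⟨l, m, rfl⟩
    · refine ⟨flat T, ?_, ?_⟩
      · simp at hlen
        simp [size, hT, hlen]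
      · simp at hlen
        simp [toList, hT', hT, hlen]
    · rw [List.concat_eq_append] at *
      have hm := hl
      rw [List.append_assoc] at hm
      obtain ⟨n1, n2, n3⟩ := hm.of_append
      have hmn : m < c + n := by
        have := hp'.mem_iff.1 (show m ∈ (l ++ [m]) ++ t by simp)
        rw [List.mem_range'_1] at this
        omega
      -- Otherwise `a` with the adjacent pair `m`, `c + n` would form a 1-23.
      have hlm : ∀ a ∈ l, ∀ b ∈ [m], b < a := by
        intro a ha b hb
        rw [List.mem_singleton] at hb
        subst hb
        have h1 := (n3 a ha).2
        simp only [List.singleton_append, List.isChain_cons_cons] at h1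
        have h2 : a ≠ b := (List.nodup_append.1 (List.nodup_append.1 hnd).1).2.2 a ha b (by simp)
        have := h1.1
        omega
      obtain ⟨k1, k2⟩ := hl₁.range'_of_append hlm
      have hm' : m = c + t.length := by simpa using k1
      have hlen' : l.length + 1 + t.length = n := by simpa using hlen
      obtain ⟨S, hS, hS'⟩ := ih l.length (by omega) k2 n1
      refine ⟨arch S T, by simp [size, hT, hS]; omega, ?_⟩
      simp only [List.length_singleton] at hS'
      rw [toList, hT, hS, hS', hT', hm', show c + l.length + t.length + 1 = c + n by omega]
      simp

end MotzkinTree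

/-! ### From permutations and embeddings to words. -/

/-- Avoidance of `132` and `1-23` in terms of positions. -/
theorem isMotzkinWord_ofFn {n : ℕ} (g : Fin n → ℕ) : IsMotzkinWord (List.ofFn g) ↔
    (∀ i j k, i < j → j < k → ¬(g i < g k ∧ g k < g j)) ∧
      ∀ i j k : Fin n, i < j → (k : ℕ) = j + 1 → ¬(g i < g j ∧ g j < g k) := by
  induction n with
  | zero => simp [IsMotzkinWord, List.ofFn_zero]
  | succ n ih =>
    rw [List.ofFn_succ, IsMotzkinWord, ih, List.pairwise_ofFn, List.isChain_iff_getElem]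
    simp only [List.length_ofFn, List.getElem_ofFn]
    constructor
    · rintro ⟨h1, h2, h3, h4⟩
      refine ⟨fun i j k hij hjk => ?_, fun i j k hij hjk => ?_⟩
      · obtain ⟨j, rfl⟩ := Fin.exists_succ_eq.2 (Fin.ne_zero_of_lt hij)
        obtain ⟨k, rfl⟩ := Fin.exists_succ_eq.2 (Fin.ne_zero_of_lt hjk)
        rw [Fin.succ_lt_succ_iff] at hjk
        cases i using Fin.cases with
        | zero => exact h1 hjk
        | succ i => exact h3 i j k (Fin.succ_lt_succ_iff.1 hij) hjk
      · have hjk' : j < k := by rw [Fin.lt_def]; omega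
        obtain ⟨j, rfl⟩ := Fin.exists_succ_eq.2 (Fin.ne_zero_of_lt hij)
        obtain ⟨k, rfl⟩ := Fin.exists_succ_eq.2 (Fin.ne_zero_of_lt hjk')
        simp only [Fin.val_succ, Nat.add_right_cancel_iff] at hjk
        cases i using Fin.cases with
        | zero =>
          have hk : k = ⟨j + 1, hjk ▸ k.2⟩ := Fin.ext hjk
          rw [hk]
          exact h2 j (hjk ▸ k.2)
        | succ i => exact h4 i j k (Fin.succ_lt_succ_iff.1 hij) hjk
    · rintro ⟨h1, h2⟩
      refine ⟨fun i j hij => h1 0 i.succ j.succ (Fin.succ_pos i) (Fin.succ_lt_succ_iff.2 hij),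
        fun i hi => h2 0 _ _ (Fin.succ_pos _) (by simp),
        fun i j k hij hjk => h1 _ _ _ (Fin.succ_lt_succ_iff.2 hij) (Fin.succ_lt_succ_iff.2 hjk),
        fun i j k hij hjk => h2 _ _ _ (Fin.succ_lt_succ_iff.2 hij) (by simp [hjk])⟩

theorem isMotzkinPerm_iff {n : ℕ} (π : Equiv.Perm (Fin n)) :
    IsMotzkinPerm π ↔ IsMotzkinWord (List.ofFn fun i => (π i : ℕ)) := by
  have hs : ∀ i j k : Fin n, i < j → j < k → StrictMono ![i, j, k] := by
    intro i j k hij hjk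
    rw [Fin.strictMono_iff_lt_succ]
    intro a
    fin_cases a
    · exact hij
    · exact hjk
  rw [isMotzkinWord_ofFn]
  simp only [← Fin.lt_def]
  refine and_congr ⟨fun h i j k hij hjk ⟨h1, h2⟩ => ?_, fun h f hf => ?_⟩
    ⟨fun h i j k hij hjk ⟨h1, h2⟩ => ?_, fun h f hf => ?_⟩
  · refine h (OrderEmbedding.ofStrictMono _ (hs i j k hij hjk)) ⟨fun a b => ?_, by simp⟩
    have h3 := h1.trans h2
    fin_cases a <;> fin_cases b <;>
      simp [Equiv.swap_apply_def, h1, h2, h3, h1.le, h2.le, h3.le]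
  · refine h (f 0) (f 1) (f 2) (f.strictMono (by decide)) (f.strictMono (by decide))
      ⟨(hf.1 0 2).2 (by decide), (hf.1 2 1).2 (by decide)⟩
  · have hjk' : j < k := by rw [Fin.lt_def]; omega
    refine h (OrderEmbedding.ofStrictMono _ (hs i j k hij hjk')) ⟨fun a b => ?_, fun a b hab ha => ?_⟩
    · have h3 := h1.trans h2
      fin_cases a <;> fin_cases b <;> simp [h1, h2, h3, h1.le, h2.le, h3.le]
    · fin_cases a <;> fin_cases b <;> simp_all
  · exact h (f 0) (f 1) (f 2) (f.strictMono (by decide)) (hf.2 1 2 rfl rfl)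
      ⟨(hf.1 0 1).2 (by decide), (hf.1 1 2).2 (by decide)⟩

open Classical in
/-- The position sequences counted by `incCount`. -/
noncomputable def incSeqs (j v : ℕ) {n : ℕ} (g : Fin n → ℕ) : Finset (Fin j → Fin n) :=
  Finset.univ.filter fun f => StrictMono f ∧ StrictMono (g ∘ f) ∧ ∀ i, v < g (f i)

open Classical in
/-- The position sequences counted by `riseCount`. -/
noncomputable def riseSeqs (j : ℕ) {n : ℕ} (g : Fin n → ℕ) : Finset (Fin (j + 2) → Fin n) :=
  Finset.univ.filter fun f => StrictMono f ∧ StrictMono (g ∘ f) ∧ (f 1 : ℕ) = f 0 + 1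

theorem strictMono_succ_comp {j n : ℕ} {f : Fin j → Fin n} :
    StrictMono (Fin.succ ∘ f) ↔ StrictMono f := by
  simp [StrictMono]

theorem exists_eq_succ_comp {j n : ℕ} {f : Fin j → Fin (n + 1)} (h : ∀ i, f i ≠ 0) :
    ∃ f' : Fin j → Fin n, f = Fin.succ ∘ f' :=
  ⟨fun i => (f i).pred (h i), by ext; simp⟩

theorem succ_comp_injective {j n : ℕ} :
    Function.Injective (fun f : Fin j → Fin n => Fin.succ ∘ f) :=
  (Fin.succ_injective n).comp_left

theorem cons_succ_comp_injective {j n : ℕ} : Function.Injective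
    (fun f : Fin j → Fin n => (Fin.cons 0 (Fin.succ ∘ f) : Fin (j + 1) → Fin (n + 1))) :=
  fun _ _ h => succ_comp_injective (Fin.cons_right_injective (α := fun _ => Fin (n + 1)) 0 h)

theorem strictMono_cons_iff {α : Type*} [Preorder α] {j : ℕ} {a : α} {f : Fin j → α} :
    StrictMono (Fin.cons a f : Fin (j + 1) → α) ↔ (∀ i, a < f i) ∧ StrictMono f := by
  constructor
  · intro h
    exact ⟨fun i => by simpa using h (Fin.succ_pos i),
      fun i i' hi => by simpa using h (Fin.succ_lt_succ_iff.2 hi)⟩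
  · rintro ⟨h1, h2⟩ i i' hi
    obtain ⟨i', rfl⟩ := Fin.exists_succ_eq.2 (Fin.ne_zero_of_lt hi)
    cases i using Fin.cases with
    | zero => simpa using h1 i'
    | succ i => simpa using h2 (Fin.succ_lt_succ_iff.1 hi)

theorem comp_cons {α β : Type*} {j : ℕ} (g : α → β) (a : α) (f : Fin j → α) :
    g ∘ (Fin.cons a f : Fin (j + 1) → α) = Fin.cons (g a) (g ∘ f) := by
  ext i
  cases i using Fin.cases <;> rfl

theorem ne_zero_of_strictMono {j n : ℕ} {f : Fin (j + 1) → Fin (n + 1)} (hf : StrictMono f)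
    (h0 : f 0 ≠ 0) (i : Fin (j + 1)) : f i ≠ 0 := by
  have := hf.monotone (Fin.zero_le i)
  exact (lt_of_lt_of_le (Fin.pos_iff_ne_zero.2 h0) this).ne'

-- Split on whether position 0 is used. If it is, its letter becomes the threshold for the rest, as
-- in the recursion of `incCount`.
open Classical in
theorem incSeqs_succ (j v : ℕ) {n : ℕ} (g : Fin (n + 1) → ℕ) :
    incSeqs (j + 1) v g = (incSeqs (j + 1) v (g ∘ Fin.succ)).image (fun f => Fin.succ ∘ f) ∪
      if v < g 0 then (incSeqs j (g 0) (g ∘ Fin.succ)).image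
        (fun f => (Fin.cons 0 (Fin.succ ∘ f) : Fin (j + 1) → Fin (n + 1))) else ∅ := by
  ext f
  rw [Finset.mem_union]
  constructor
  · intro hf
    obtain ⟨h1, h2, h3⟩ := (Finset.mem_filter.1 hf).2
    by_cases h0 : f 0 = 0
    · right
      rw [if_pos (h0 ▸ h3 0), Finset.mem_image]
      obtain ⟨f', hf'⟩ := exists_eq_succ_comp (f := Fin.tail f)
        fun i => (lt_of_le_of_lt (Fin.zero_le (f 0)) (h1 (Fin.succ_pos i))).ne'
      have hf : f = Fin.cons 0 (Fin.succ ∘ f') := by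
        rw [← hf', ← h0, Fin.cons_self_tail]
      subst hf
      rw [comp_cons, strictMono_cons_iff] at h2
      rw [strictMono_cons_iff, strictMono_succ_comp] at h1
      exact ⟨f', Finset.mem_filter.2 ⟨Finset.mem_univ _, h1.2, h2.2, h2.1⟩, rfl⟩
    · left
      obtain ⟨f', rfl⟩ := exists_eq_succ_comp (ne_zero_of_strictMono h1 h0)
      exact Finset.mem_image.2 ⟨f', Finset.mem_filter.2
        ⟨Finset.mem_univ _, strictMono_succ_comp.1 h1, h2, h3⟩, rfl⟩
  · rintro (h | h)
    · obtain ⟨f', hf', rfl⟩ := Finset.mem_image.1 h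
      obtain ⟨h1, h2, h3⟩ := (Finset.mem_filter.1 hf').2
      exact Finset.mem_filter.2 ⟨Finset.mem_univ _, strictMono_succ_comp.2 h1, h2, h3⟩
    · split_ifs at h with hv
      · obtain ⟨f', hf', rfl⟩ := Finset.mem_image.1 h
        obtain ⟨h1, h2, h3⟩ := (Finset.mem_filter.1 hf').2
        refine Finset.mem_filter.2 ⟨Finset.mem_univ _, ?_, ?_, ?_⟩
        · exact strictMono_cons_iff.2 ⟨fun i => Fin.succ_pos _, strictMono_succ_comp.2 h1⟩
        · rw [comp_cons]
          exact strictMono_cons_iff.2 ⟨h3, h2⟩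
        · intro i
          cases i using Fin.cases with
          | zero => exact hv
          | succ i => exact hv.trans (h3 i)
      · simp at h

theorem card_incSeqs_zero (v : ℕ) {n : ℕ} (g : Fin n → ℕ) : (incSeqs 0 v g).card = 1 := by
  rw [Finset.card_eq_one]
  refine ⟨Fin.elim0, Finset.eq_singleton_iff_unique_mem.2
    ⟨Finset.mem_filter.2 ⟨Finset.mem_univ _, fun i => i.elim0, fun i => i.elim0, fun i => i.elim0⟩,
      fun f _ => Subsingleton.elim _ _⟩⟩

theorem card_incSeqs (j v : ℕ) {n : ℕ} (g : Fin n → ℕ) :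
    (incSeqs j v g).card = incCount j v (List.ofFn g) := by
  classical
  induction n generalizing j v with
  | zero =>
    cases j with
    | zero => rw [incCount_zero, card_incSeqs_zero]
    | succ j =>
      rw [List.ofFn_zero, incCount, Finset.card_eq_zero]
      exact Finset.eq_empty_of_forall_notMem fun f => (f 0).elim0
  | succ n ih =>
    cases j with
    | zero => rw [incCount_zero, card_incSeqs_zero]
    | succ j =>
      rw [List.ofFn_succ, incCount_succ_cons, incSeqs_succ, Finset.card_union_of_disjoint,
        Finset.card_image_of_injective _ succ_comp_injective, ih]
      · congr 1
        split_ifs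
        · rw [Finset.card_image_of_injective _ cons_succ_comp_injective, ih]
          rfl
        · simp
      · split_ifs
        · rw [Finset.disjoint_left]
          intro f hf hf'
          obtain ⟨f₁, _, rfl⟩ := Finset.mem_image.1 hf
          obtain ⟨f₂, _, h⟩ := Finset.mem_image.1 hf'
          exact Fin.succ_ne_zero _ (congrFun h 0).symm
        · simp

-- A sequence using position 0 must by adjacency use position 1 next; what remains is an increasing
-- sequence above `g 1` from position 2 on.
open Classical in
theorem riseSeqs_succ (j : ℕ) {n : ℕ} (g : Fin (n + 2) → ℕ) :
    riseSeqs j g = (riseSeqs j (g ∘ Fin.succ)).image (fun f => Fin.succ ∘ f) ∪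
      if g 0 < g 1 then (incSeqs j (g 1) (g ∘ Fin.succ ∘ Fin.succ)).image
        (fun f => (Fin.cons 0 (Fin.succ ∘ (Fin.cons 0 (Fin.succ ∘ f) : Fin (j + 1) → Fin (n + 1))) :
          Fin (j + 2) → Fin (n + 2))) else ∅ := by
  ext f
  rw [Finset.mem_union]
  constructor
  · intro hf
    obtain ⟨h1, h2, h3⟩ := (Finset.mem_filter.1 hf).2
    by_cases h0 : f 0 = 0
    · right
      have h01 : f 1 = 1 := by
        rw [h0] at h3
        exact Fin.ext (by simpa using h3)
      rw [if_pos (by have := h2 (show (0 : Fin (j + 2)) < 1 by simp); simpa [h0, h01] using this),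
        Finset.mem_image]
      obtain ⟨f', hf'⟩ := exists_eq_succ_comp (f := Fin.tail f)
        fun i => (lt_of_le_of_lt (Fin.zero_le (f 0)) (h1 (Fin.succ_pos i))).ne'
      have hf : f = Fin.cons 0 (Fin.succ ∘ f') := by
        rw [← hf', ← h0, Fin.cons_self_tail]
      subst hf
      rw [comp_cons, strictMono_cons_iff] at h2
      rw [strictMono_cons_iff, strictMono_succ_comp] at h1
      have h0' : f' 0 = 0 := Fin.succ_injective _ (by simpa using h01)
      obtain ⟨f'', hf''⟩ := exists_eq_succ_comp (f := Fin.tail f')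
        fun i => (lt_of_le_of_lt (Fin.zero_le (f' 0)) (h1.2 (Fin.succ_pos i))).ne'
      have hf : f' = Fin.cons 0 (Fin.succ ∘ f'') := by
        rw [← hf'', ← h0', Fin.cons_self_tail]
      subst hf
      have h2' := h2.2
      rw [comp_cons, comp_cons, strictMono_cons_iff] at h2'
      have h1' := h1.2
      rw [strictMono_cons_iff, strictMono_succ_comp] at h1'
      exact ⟨f'', Finset.mem_filter.2 ⟨Finset.mem_univ _, h1'.2, h2'.2, h2'.1⟩, rfl⟩
    · left
      obtain ⟨f', rfl⟩ := exists_eq_succ_comp (ne_zero_of_strictMono h1 h0)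
      exact Finset.mem_image.2 ⟨f', Finset.mem_filter.2
        ⟨Finset.mem_univ _, strictMono_succ_comp.1 h1, h2, by simpa using h3⟩, rfl⟩
  · rintro (h | h)
    · obtain ⟨f', hf', rfl⟩ := Finset.mem_image.1 h
      obtain ⟨h1, h2, h3⟩ := (Finset.mem_filter.1 hf').2
      exact Finset.mem_filter.2 ⟨Finset.mem_univ _, strictMono_succ_comp.2 h1, h2, by simp [h3]⟩
    · split_ifs at h with hv
      · obtain ⟨f', hf', rfl⟩ := Finset.mem_image.1 h
        obtain ⟨h1, h2, h3⟩ := (Finset.mem_filter.1 hf').2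
        refine Finset.mem_filter.2 ⟨Finset.mem_univ _, ?_, ?_, by simp⟩
        · exact strictMono_cons_iff.2 ⟨fun i => Fin.succ_pos _, strictMono_succ_comp.2
            (strictMono_cons_iff.2 ⟨fun i => Fin.succ_pos _, strictMono_succ_comp.2 h1⟩)⟩
        · rw [comp_cons, comp_cons, comp_cons, strictMono_cons_iff, strictMono_cons_iff]
          refine ⟨fun i => ?_, h3, h2⟩
          cases i using Fin.cases with
          | zero => exact hv
          | succ i => exact hv.trans (h3 i)
      · simp at h

theorem card_riseSeqs (j : ℕ) {n : ℕ} (g : Fin n → ℕ) :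
    (riseSeqs j g).card = riseCount j (List.ofFn g) := by
  classical
  induction n with
  | zero =>
    rw [List.ofFn_zero, riseCount, Finset.card_eq_zero]
    exact Finset.eq_empty_of_forall_notMem fun f => (f 0).elim0
  | succ n ih =>
    cases n with
    | zero =>
      rw [List.ofFn_succ, List.ofFn_zero, riseCount, Finset.card_eq_zero]
      refine Finset.eq_empty_of_forall_notMem fun f hf => ?_
      have := (Finset.mem_filter.1 hf).2.2.2
      omega
    | succ n =>
      rw [List.ofFn_succ, List.ofFn_succ, riseCount_cons_cons, riseSeqs_succ,
        Finset.card_union_of_disjoint, Finset.card_image_of_injective _ succ_comp_injective, ih]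
      · congr 1
        · rw [List.ofFn_succ]; rfl
        split_ifs with h1 h2 h2
        · rw [Finset.card_image_of_injective, card_incSeqs]
          · rfl
          · exact cons_succ_comp_injective.comp cons_succ_comp_injective
        · exact absurd h1 h2
        · exact absurd h2 h1
        · simp
      · split_ifs
        · rw [Finset.disjoint_left]
          intro f hf hf'
          obtain ⟨f₁, _, rfl⟩ := Finset.mem_image.1 hf
          obtain ⟨f₂, _, h⟩ := Finset.mem_image.1 hf'
          exact Fin.succ_ne_zero _ (congrFun h 0).symm
        · simp

theorem occurrences_eq_riseCount (j : ℕ) {n : ℕ} (π : Equiv.Perm (Fin n)) :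
    occurrences (Equiv.refl (Fin (j + 2))) {0} π = riseCount j (List.ofFn fun i => (π i : ℕ)) := by
  rw [← card_riseSeqs, occurrences, ← Nat.card_eq_finsetCard]
  refine Nat.card_congr ⟨fun f => ⟨f.1, Finset.mem_filter.2 ⟨Finset.mem_univ _, f.1.strictMono,
    fun a b hab => (f.2.1 a b).2 hab, f.2.2 0 1 rfl rfl⟩⟩,
    fun f => ⟨OrderEmbedding.ofStrictMono f.1 (Finset.mem_filter.1 f.2).2.1, ?_, ?_⟩,
    fun f => Subtype.ext (by ext; rfl), fun f => rfl⟩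
  · exact fun a b => (Finset.mem_filter.1 f.2).2.2.1.lt_iff_lt
  · intro a b hab ha
    have ha' : a = 0 := Fin.ext ha
    subst ha'
    have hb : b = 1 := Fin.ext (by simpa using hab)
    subst hb
    exact (Finset.mem_filter.1 f.2).2.2.2

/-! ### Weight enumerators of Motzkin paths. -/

namespace MotzkinTree

theorem finite_setOf_size_eq (n : ℕ) : {t : MotzkinTree | t.size = n}.Finite := by
  refine Set.Finite.of_finite_image (f := toList 0) (Set.Finite.subset
    (List.finite_toSet (List.range' 0 n).permutations) ?_) (toList_injective 0).injOn
  rintro _ ⟨t, rfl, rfl⟩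
  exact List.mem_permutations.2 (toList_perm 0 t)

/-- The Motzkin paths of length `n`. -/
noncomputable def ofSize (n : ℕ) : Finset MotzkinTree := (finite_setOf_size_eq n).toFinset

@[simp] theorem mem_ofSize {n : ℕ} {t : MotzkinTree} : t ∈ ofSize n ↔ t.size = n := by
  simp [ofSize]

theorem ofSize_zero : ofSize 0 = {leaf} := by
  ext t
  cases t <;> simp [size]

theorem sum_ofSize_one {M : Type*} [AddCommMonoid M] (f : MotzkinTree → M) :
    ∑ t ∈ ofSize 1, f t = f (flat leaf) := by
  have : ofSize 1 = {flat leaf} := by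
    ext t
    cases t with
    | leaf => simp [size]
    | flat t => cases t <;> simp [size]
    | arch s t => simp [size]
  rw [this, Finset.sum_singleton]

theorem sum_ofSize_add_two {M : Type*} [AddCommMonoid M] (f : MotzkinTree → M) (n : ℕ) :
    ∑ t ∈ ofSize (n + 2), f t = ∑ t ∈ ofSize (n + 1), f (flat t) +
      ∑ p ∈ Finset.HasAntidiagonal.antidiagonal n, ∑ s ∈ ofSize p.1, ∑ t ∈ ofSize p.2, f (arch s t) := by
  have h : ofSize (n + 2) = (ofSize (n + 1)).image flat ∪
      (Finset.HasAntidiagonal.antidiagonal n).biUnion fun p =>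
        (ofSize p.1 ×ˢ ofSize p.2).image fun q => arch q.1 q.2 := by
    ext t
    cases t with
    | leaf => simp [size]
    | flat t => simp [size]
    | arch s t =>
      simp only [Finset.mem_union, Finset.mem_image, Finset.mem_biUnion, Finset.mem_product,
        mem_ofSize, Finset.HasAntidiagonal.mem_antidiagonal, size]
      constructor
      · intro h
        exact Or.inr ⟨(s.size, t.size), by simp; omega, (s, t), ⟨rfl, rfl⟩, rfl⟩
      · rintro (⟨_, _, h⟩ | ⟨p, hp, q, ⟨h1, h2⟩, h⟩)
        · cases h
        · cases h
          omega
  rw [h, Finset.sum_union, Finset.sum_image (fun a _ b _ h => by injection h),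
    Finset.sum_biUnion]
  · congr 1
    refine Finset.sum_congr rfl fun p _ => ?_
    rw [Finset.sum_image, Finset.sum_product]
    rintro ⟨a, b⟩ _ ⟨c, d⟩ _ h
    simpa using h
  · intro p _ p' _ hpp
    rw [Function.onFun, Finset.disjoint_left]
    intro t ht ht'
    obtain ⟨q, hq, rfl⟩ := Finset.mem_image.1 ht
    obtain ⟨q', hq', h⟩ := Finset.mem_image.1 ht'
    simp only [arch.injEq] at h
    simp only [Finset.mem_product, mem_ofSize] at hq hq'
    exact hpp (Prod.ext (by rw [← hq.1, ← hq'.1, h.1]) (by rw [← hq.2, ← hq'.2, h.2]))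
  · rw [Finset.disjoint_left]
    intro t ht ht'
    obtain ⟨q, _, rfl⟩ := Finset.mem_image.1 ht
    simp at ht'

open Polynomial in
/-- The weight enumerator of the Motzkin paths of length `n`. -/
noncomputable def weightPoly (w : ℕ → ℕ) (n : ℕ) : ℚ[X] := ∑ t ∈ ofSize n, X ^ weight w t

open Polynomial in
theorem weightPoly_zero (w : ℕ → ℕ) : weightPoly w 0 = 1 := by
  simp [weightPoly, ofSize_zero, weight]

open Polynomial in
theorem weightPoly_one (w : ℕ → ℕ) : weightPoly w 1 = weightPoly w 0 := by
  simp [weightPoly, sum_ofSize_one, ofSize_zero, weight]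

open Polynomial in
theorem weightPoly_add_two (w : ℕ → ℕ) (n : ℕ) : weightPoly w (n + 2) = weightPoly w (n + 1) +
    X ^ w 0 * ∑ p ∈ Finset.HasAntidiagonal.antidiagonal n,
      weightPoly (fun i => w (i + 1)) p.1 * weightPoly w p.2 := by
  simp only [weightPoly, sum_ofSize_add_two, weight, Finset.mul_sum, Finset.sum_mul, pow_add]
  refine congrArg₂ (· + ·) rfl (Finset.sum_congr rfl fun p _ => ?_)
  rw [Finset.sum_comm]
  exact Finset.sum_congr rfl fun _ _ => Finset.sum_congr rfl fun _ _ => by ring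

theorem coeff_weightPoly (w : ℕ → ℕ) (n r : ℕ) :
    (weightPoly w n).coeff r = (((ofSize n).filter fun t => weight w t = r).card : ℚ) := by
  simp [weightPoly, Polynomial.finsetSum_coeff, Polynomial.coeff_X_pow, eq_comm]

end MotzkinTree

/-! ### The bivariate series, with q outermost so that its coefficients are series in x. -/

/-- The series `∑ a n x ^ n`, expanded in the variable `q` of the polynomials `a n`. -/
noncomputable def swapSeries (a : ℕ → Polynomial ℚ) : PowerSeries (PowerSeries ℚ) :=
  PowerSeries.mk fun r => PowerSeries.mk fun n => (a n).coeff r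

open PowerSeries in
theorem swapSeries_mul (a b : ℕ → Polynomial ℚ) : swapSeries a * swapSeries b =
    swapSeries fun n => ∑ p ∈ Finset.HasAntidiagonal.antidiagonal n, a p.1 * b p.2 := by
  ext r n
  simp only [swapSeries, coeff_mul, coeff_mk, map_sum, Polynomial.finsetSum_coeff,
    Polynomial.coeff_mul]
  exact Finset.sum_comm

open PowerSeries in
theorem X_pow_mul_swapSeries (m : ℕ) (a : ℕ → Polynomial ℚ) :
    X ^ m * swapSeries a = swapSeries fun n => Polynomial.X ^ m * a n := by
  ext r n
  simp only [swapSeries, coeff_X_pow_mul', coeff_mk, Polynomial.coeff_X_pow_mul']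
  split_ifs <;> simp

open PowerSeries in
/-- The functional equation of the weight enumerator of Motzkin paths. -/
theorem swapSeries_weightPoly (w : ℕ → ℕ) :
    swapSeries (MotzkinTree.weightPoly w) = 1 + C X * swapSeries (MotzkinTree.weightPoly w) +
      C (X ^ 2) * (X ^ w 0 * (swapSeries (MotzkinTree.weightPoly fun i => w (i + 1)) *
        swapSeries (MotzkinTree.weightPoly w))) := by
  rw [swapSeries_mul, X_pow_mul_swapSeries]
  ext r n
  simp only [map_add, coeff_C_mul, swapSeries, coeff_mk]
  rcases n with _ | _ | n
  · simp [MotzkinTree.weightPoly_zero, coeff_one, Polynomial.coeff_one, coeff_X_pow_mul',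
      coeff_zero_eq_constantCoeff]
  · rw [coeff_succ_X_mul, coeff_mk, coeff_X_pow_mul', if_neg (by omega),
      MotzkinTree.weightPoly_one, coeff_one, add_zero]
    split_ifs <;> simp [coeff_one]
  · have h1 : coeff (n + 1 + 1) (coeff r (1 : PowerSeries (PowerSeries ℚ))) = 0 := by
      rw [coeff_one]
      split_ifs <;> simp [coeff_one]
    rw [coeff_succ_X_mul, coeff_mk, coeff_X_pow_mul', if_pos (by omega), h1, zero_add, coeff_mk,
      MotzkinTree.weightPoly_add_two, Polynomial.coeff_add]
    rfl

/-! ### Motzkin permutations and weighted Motzkin paths are equinumerous. -/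

/-- Every arrangement of `0, …, n - 1` is the word of a permutation of `Fin n`. -/
theorem exists_perm_ofFn_eq {n : ℕ} {l : List ℕ} (h : l.Perm (List.range' 0 n)) :
    ∃ π : Equiv.Perm (Fin n), (List.ofFn fun i => (π i : ℕ)) = l := by
  have hlen : l.length = n := by simpa using h.length_eq
  subst hlen
  have hlt : ∀ i : Fin l.length, l[i] < l.length := fun i => by
    simpa using h.mem_iff.1 (List.getElem_mem i.2)
  have hinj : Function.Injective fun i : Fin l.length => (⟨l[i], hlt i⟩ : Fin l.length) := by
    intro i i' hi
    have hnd : l.Nodup := h.nodup_iff.2 List.nodup_range'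
    exact Fin.ext ((hnd.getElem_inj_iff).1 (congrArg Fin.val hi))
  exact ⟨Equiv.ofBijective _ (Finite.injective_iff_bijective.1 hinj), List.ofFn_getElem⟩

theorem perm_ofFn_range' {n : ℕ} (π : Equiv.Perm (Fin n)) :
    (List.ofFn fun i => (π i : ℕ)).Perm (List.range' 0 n) := by
  have h : (List.ofFn π).Perm (List.finRange n) := by
    simpa [List.map_id, List.ofFn_eq_map] using π.map_finRange_perm
  have := h.map Fin.val
  simpa [List.map_ofFn, List.range_eq_range', Function.comp_def] using this

/-- Motzkin permutations are equinumerous with Motzkin paths, in such a way that the occurrences of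
`12-3-…-(j+2)` become weighted up steps. -/
theorem motzkinCount_eq (j r n : ℕ) : motzkinCount (j + 2) r n =
    ((MotzkinTree.ofSize n).filter
      fun t => MotzkinTree.weight (fun i => i.choose j) t = r).card := by
  set φ : Equiv.Perm (Fin n) → List ℕ := fun π => List.ofFn fun i => (π i : ℕ) with hφ
  have hinj : Function.Injective φ := by
    intro π π' h
    have := List.ofFn_injective h
    exact Equiv.ext fun i => Fin.ext (congrFun this i)
  set S : Set (Equiv.Perm (Fin n)) := {π | IsMotzkinPerm π ∧
    occurrences (Equiv.refl (Fin (j + 2))) {0} π = r}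
  -- Both families embed injectively into words, so equal images give equal cardinalities.
  have himg : φ '' S = MotzkinTree.toList 0 '' ((MotzkinTree.ofSize n).filter
      fun t => MotzkinTree.weight (fun i => i.choose j) t = r) := by
    ext l
    constructor
    · rintro ⟨π, ⟨h1, h2⟩, rfl⟩
      rw [isMotzkinPerm_iff] at h1
      obtain ⟨t, ht, ht'⟩ := MotzkinTree.exists_toList_eq (perm_ofFn_range' π) h1
      refine ⟨t, ?_, ht'⟩
      rw [occurrences_eq_riseCount, ← ht', MotzkinTree.riseCount_toList] at h2
      simpa using ⟨ht, h2⟩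
    · rintro ⟨t, ht, rfl⟩
      simp only [Finset.coe_filter, MotzkinTree.mem_ofSize, Set.mem_ofPred_eq] at ht
      obtain ⟨π, hπ⟩ := exists_perm_ofFn_eq (ht.1 ▸ t.toList_perm 0)
      refine ⟨π, ⟨?_, ?_⟩, hπ⟩
      · rw [isMotzkinPerm_iff, hπ]
        exact t.isMotzkinWord_toList 0
      · rw [occurrences_eq_riseCount, hπ, MotzkinTree.riseCount_toList, ht.2]
  calc motzkinCount (j + 2) r n = S.ncard := Nat.card_coe_set_eq S
    _ = (φ '' S).ncard := (Set.ncard_image_of_injective S hinj).symm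
    _ = _ := by
      rw [himg, Set.ncard_image_of_injective _ (MotzkinTree.toList_injective 0),
        Set.ncard_coe_finset]

theorem motzkinGF_eq_coeff (j r : ℕ) : motzkinGF (j + 2) r =
    PowerSeries.coeff r (swapSeries (MotzkinTree.weightPoly fun i => i.choose j)) := by
  ext n
  rw [motzkinGF, swapSeries, PowerSeries.coeff_mk, PowerSeries.coeff_mk, PowerSeries.coeff_mk,
    MotzkinTree.coeff_weightPoly, motzkinCount_eq]

/-! ### Chebyshev identities over Laurent series. -/

theorem xL_ne_zero : xL ≠ 0 := by
  intro h
  exact PowerSeries.X_ne_zero (HahnSeries.ofPowerSeries_injective (Γ := ℤ) (R := ℚ)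
    (h.trans (map_zero _).symm))

theorem one_sub_xL_ne_zero : 1 - xL ≠ 0 := by
  intro h
  have h1 : (1 - PowerSeries.X : PowerSeries ℚ) = 0 := by
    apply HahnSeries.ofPowerSeries_injective (Γ := ℤ)
    rw [map_sub, map_one, map_zero]
    exact h
  simpa using congrArg PowerSeries.constantCoeff h1

theorem chebU_zero : chebU 0 = 1 := by simp [chebU]

theorem chebU_neg_one : chebU (-1) = 0 := by simp [chebU]

theorem xL_mul_chebU_add_two (m : ℤ) :
    xL * chebU (m + 2) = (1 - xL) * chebU (m + 1) - xL * chebU m := by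
  have h := xL_ne_zero
  simp only [chebU, Polynomial.Chebyshev.U_add_two, map_sub, map_mul, Polynomial.aeval_X, map_ofNat]
  have : CharZero (LaurentSeries ℚ) := algebraRat.charZero _
  field_simp

/-- Cassini's identity: the three-term recurrence preserves this determinant. -/
theorem chebU_sq_sub (n : ℕ) : chebU n ^ 2 - chebU ((n : ℤ) - 1) * chebU (n + 1) = 1 := by
  induction n with
  | zero => simp [chebU_zero, chebU_neg_one]
  | succ n ih =>
    have h1 := xL_mul_chebU_add_two n
    have h2 := xL_mul_chebU_add_two ((n : ℤ) - 1)
    rw [show (n : ℤ) - 1 + 2 = n + 1 by ring, show (n : ℤ) - 1 + 1 = n by ring] at h2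
    push_cast
    rw [show (n : ℤ) + 1 - 1 = n by ring, show (n : ℤ) + 1 + 1 = n + 2 by ring]
    apply mul_left_cancel₀ xL_ne_zero
    linear_combination xL * ih + chebU (n + 1) * h2 - chebU n * h1

/-! ### Convergents of the truncated continued fraction. -/

/-- The denominators of the convergents of the continued fraction
`1 / (1 - x - x ^ 2 / (⋯ / (1 - x - x ^ 2 * q / (1 - x))))`. -/
noncomputable def convergentDen (n : ℕ) : PowerSeries (LaurentSeries ℚ) :=
  PowerSeries.C ((1 - xL) * (xL ^ n * chebU n)) -
    PowerSeries.X * PowerSeries.C (xL ^ (n + 1) * chebU ((n : ℤ) - 1))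

theorem convergentDen_zero : convergentDen 0 = PowerSeries.C (1 - xL) := by
  simp [convergentDen, chebU_zero, chebU_neg_one]

theorem convergentDen_one :
    convergentDen 1 = PowerSeries.C ((1 - xL) ^ 2) - PowerSeries.X * PowerSeries.C (xL ^ 2) := by
  have h := xL_mul_chebU_add_two (-1)
  norm_num [chebU_zero, chebU_neg_one] at h
  simp [convergentDen, chebU_zero, h, sq]

/-- Multiplying x U_(m+2) = (1 - x) U_(m+1) - x U_m by x^(m+1) gives this recurrence for x^m U_m,
and both q-coefficients are multiples of such terms. -/
theorem convergentDen_add_two (n : ℕ) : convergentDen (n + 2) =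
    PowerSeries.C (1 - xL) * convergentDen (n + 1) - PowerSeries.C (xL ^ 2) * convergentDen n := by
  have h1 := xL_mul_chebU_add_two n
  have h2 := xL_mul_chebU_add_two ((n : ℤ) - 1)
  rw [show (n : ℤ) - 1 + 2 = n + 1 by ring, show (n : ℤ) - 1 + 1 = n by ring] at h2
  have e1 : (1 - xL) * (xL ^ (n + 2) * chebU (n + 2)) = (1 - xL) * ((1 - xL) *
      (xL ^ (n + 1) * chebU (n + 1))) - xL ^ 2 * ((1 - xL) * (xL ^ n * chebU n)) := by
    linear_combination (1 - xL) * xL ^ (n + 1) * h1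
  have e2 : xL ^ (n + 3) * chebU (n + 1) = (1 - xL) * (xL ^ (n + 2) * chebU n) -
      xL ^ 2 * (xL ^ (n + 1) * chebU ((n : ℤ) - 1)) := by
    linear_combination xL ^ (n + 2) * h2
  simp only [convergentDen]
  push_cast
  rw [show (n : ℤ) + 1 - 1 = n by ring, show (n : ℤ) + 2 - 1 = n + 1 by ring, e1,
    show n + 2 + 1 = n + 3 from rfl, e2, show n + 1 + 1 = n + 2 from rfl]
  simp only [map_sub, map_mul]
  ring

/-- The enumerator of Motzkin paths in which an up step starting at height `i` has weight
`(i + d).choose j`, over the field of Laurent series. -/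
noncomputable def chooseSeries (j d : ℕ) : PowerSeries (LaurentSeries ℚ) :=
  PowerSeries.map (HahnSeries.ofPowerSeries ℤ ℚ)
    (swapSeries (MotzkinTree.weightPoly fun i => (i + d).choose j))

open PowerSeries in
theorem chooseSeries_eq (j d : ℕ) : chooseSeries j d = 1 + C xL * chooseSeries j d +
    C (xL ^ 2) * (X ^ d.choose j * (chooseSeries j (d + 1) * chooseSeries j d)) := by
  have h := congrArg (PowerSeries.map (HahnSeries.ofPowerSeries ℤ ℚ))
    (swapSeries_weightPoly fun i => (i + d).choose j)
  simp only [map_add, map_mul, map_one, map_pow, PowerSeries.map_C, PowerSeries.map_X,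
    Nat.zero_add] at h
  simp only [show ∀ i, i + 1 + d = i + (d + 1) by intro i; ring] at h
  rw [map_pow]
  exact h

-- Descending induction on the height `j - e`: levels below j carry no q, so each multiplies the
-- error by a series and creates no new one.
open PowerSeries in
theorem X_pow_dvd_convergentDen_mul_sub (j e : ℕ) (he : e ≤ j) :
    (X : PowerSeries (LaurentSeries ℚ)) ^ (j + 2) ∣
      convergentDen (e + 1) * chooseSeries j (j - e) - convergentDen e := by
  induction e with
  | zero =>
    have h1 := chooseSeries_eq j j
    have h2 := chooseSeries_eq j (j + 1)
    rw [Nat.choose_self, pow_one] at h1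
    rw [Nat.choose_succ_self_right] at h2
    -- The error comes from the arches at height j+1: they carry q^(j+1), and the enclosing arch at
    -- height j supplies one more factor q.
    refine ⟨C (xL ^ 2) * C (xL ^ 2) * chooseSeries j j * chooseSeries j (j + 2) *
      chooseSeries j (j + 1), ?_⟩
    rw [Nat.sub_zero, convergentDen_zero, convergentDen_one]
    simp only [map_sub, map_pow, map_one] at h1 h2 ⊢
    rw [pow_succ _ (j + 1)]
    linear_combination (1 - C xL) * h1 + X * C xL ^ 2 * chooseSeries j j * h2
  | succ e ih =>
    obtain ⟨y, hy⟩ := ih (by omega)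
    have h1 := chooseSeries_eq j (j - (e + 1))
    rw [Nat.choose_eq_zero_of_lt (by omega), pow_zero,
      show j - (e + 1) + 1 = j - e by omega] at h1
    refine ⟨C (xL ^ 2) * chooseSeries j (j - (e + 1)) * y, ?_⟩
    rw [convergentDen_add_two]
    simp only [map_sub, map_one] at h1 ⊢
    linear_combination convergentDen (e + 1) * h1 +
      C (xL ^ 2) * chooseSeries j (j - (e + 1)) * hy

theorem coeff_chooseSeries_zero (j r : ℕ) : PowerSeries.coeff r (chooseSeries j 0) =
    ((motzkinGF (j + 2) r : PowerSeries ℚ) : LaurentSeries ℚ) := by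
  rw [motzkinGF_eq_coeff, chooseSeries, PowerSeries.coeff_map]
  rfl

/-! ### Extraction of the coefficients of q. -/

theorem mainTheorem11 (k : ℕ) (hk : 2 ≤ k) :
    ((motzkinGF k 0 : PowerSeries ℚ) : LaurentSeries ℚ)
        = chebU ((k : ℤ) - 2) / (xL * chebU ((k : ℤ) - 1)) ∧
    ∀ r : ℕ, 1 ≤ r → r ≤ k - 1 →
      ((motzkinGF k r : PowerSeries ℚ) : LaurentSeries ℚ)
        = xL ^ (r - 1) * chebU ((k : ℤ) - 2) ^ (r - 1)
          / ((1 - xL) ^ r * chebU ((k : ℤ) - 1) ^ (r + 1)) := by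
  obtain ⟨j, rfl⟩ := Nat.exists_eq_add_of_le' hk
  have hx := xL_ne_zero
  have hx1 := one_sub_xL_ne_zero
  have hdvd := X_pow_dvd_convergentDen_mul_sub j j le_rfl
  rw [Nat.sub_self, PowerSeries.X_pow_dvd_iff] at hdvd
  simp only [← coeff_chooseSeries_zero]
  set A := chooseSeries j 0
  have hcas := chebU_sq_sub j
  simp only [convergentDen] at hdvd
  push_cast at hdvd ⊢
  rw [show (j : ℤ) + 1 - 1 = j by ring] at hdvd
  rw [show (j : ℤ) + 2 - 2 = j by ring, show (j : ℤ) + 2 - 1 = j + 1 by ring]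
  generalize chebU ((j : ℤ) - 1) = t at *
  generalize chebU (j : ℤ) = u at *
  generalize chebU ((j : ℤ) + 1) = v at *
  have h0 : xL * v * PowerSeries.coeff 0 A = u := by
    have h := hdvd 0 (by omega)
    rw [sub_mul, mul_assoc PowerSeries.X] at h
    simp only [map_sub, PowerSeries.coeff_C_mul, PowerSeries.coeff_zero_X_mul,
      PowerSeries.coeff_zero_C] at h
    apply mul_left_cancel₀ (mul_ne_zero hx1 (pow_ne_zero j hx))
    linear_combination h
  -- If `v` vanished, so would `u` by `h0`, contradicting Cassini.
  have hv : v ≠ 0 := by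
    rintro rfl
    have hu : u = 0 := by simpa using h0.symm
    simp [hu] at hcas
  have h1 : (1 - xL) * v * PowerSeries.coeff 1 A = xL * u * PowerSeries.coeff 0 A - t := by
    have h := hdvd 1 (by omega)
    rw [sub_mul, mul_assoc PowerSeries.X, ← zero_add 1] at h
    simp only [map_sub, PowerSeries.coeff_C_mul, PowerSeries.coeff_succ_X_mul,
      PowerSeries.coeff_zero_C, PowerSeries.coeff_succ_C] at h
    apply mul_left_cancel₀ (pow_ne_zero (j + 1) hx)
    linear_combination h
  -- The numerator D_j is linear in q, so from q² on it contributes nothing and consecutive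
  -- coefficients have a fixed ratio.
  have hrec : ∀ r, r + 2 < j + 2 →
      (1 - xL) * v * PowerSeries.coeff (r + 2) A = xL * u * PowerSeries.coeff (r + 1) A := by
    intro r hr
    have h := hdvd (r + 2) hr
    rw [sub_mul, mul_assoc PowerSeries.X] at h
    simp only [map_sub, PowerSeries.coeff_C_mul, PowerSeries.coeff_succ_X_mul,
      PowerSeries.coeff_succ_C] at h
    apply mul_left_cancel₀ (pow_ne_zero (j + 1) hx)
    linear_combination h
  have hA0 : PowerSeries.coeff 0 A = u / (xL * v) := by
    rw [eq_div_iff (mul_ne_zero hx hv)]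
    linear_combination h0
  refine ⟨hA0, fun r hr hrk => ?_⟩
  obtain ⟨r, rfl⟩ := Nat.exists_eq_add_of_le' hr
  rw [Nat.add_sub_cancel]
  induction r with
  | zero =>
    rw [zero_add, eq_div_iff (by positivity)]
    -- After multiplication by `v` the right side becomes `u ^ 2 - t * v`, which is 1 by Cassini.
    linear_combination v * h1 + u * h0 + hcas
  | succ r ih =>
    have h := hrec r (by omega)
    rw [ih (by omega) (by omega)] at h
    apply mul_left_cancel₀ (mul_ne_zero hx1 hv)
    rw [h]
    field_simp
    ring
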